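/- Let $R$ be a complete discrete valuation ring with residue field $k$ and uniformizer $\pi$, let $n,r\ge 0$ be integers, let $A=R[[S_1,\dots,S_n,Z]]$ and $\mathfrak X=\operatorname{Spf}A$, where $A$ carries its $(\pi,S_1,\dots,S_n,Z)$-adic topology. Let $f\in A$ be $Z$-distinguished, i.e. its reduction in $k[[Z]]$ (set all $S_i=0$ and reduce coefficients modulo $\pi$) is a nonzero non-unit. Let $\mathfrak X'=\operatorname{Spf}A'$ be the affine part of the admissible formal blowup of $\mathfrak X$ in the ideal $(\pi^{r+1},S_1,\dots,S_n)$ where the pullback ideal is generated by $\pi^{r+1}$; that is, $A'$ is the $(\pi,S_1,\dots,S_n,Z)$-adic completion of the affine blowup algebra $A[S_1/\pi^{r+1},\dots,S_n/\pi^{r+1}]\subseteq A[1/\pi]$. Let $\mathfrak X_\pi$ and $(\mathfrak X')_\pi$ denote the envelopes of $\mathfrak X$ and $\mathfrak X'$, i.e. the formal spectra of $A$ and $A'$ equipped with their $\pi$-adic topologies, and let $\mathfrak X_{\pi,f}\subseteq\mathfrak X_\pi$ and $(\mathfrak X')_{\pi,f}\subseteq(\mathfrak X')_\pi$ denote the non-vanishing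 loci of $f$ and of its pullback. **Theorem.** Let $g$ and $h$ be global functions on $\mathfrak X_{\pi,f}$ and on $(\mathfrak X')_\pi$ respectively whose pullbacks to $(\mathfrak X')_{\pi,f}$ coincide. Then there is a unique global function $u$ on $\mathfrak X_\pi$ whose pullback to $\mathfrak X_{\pi,f}$ is $g$ and whose pullback to $(\mathfrak X')_\pi$ is $h$. -/

import Mathlib

namespace FormalHartogs

noncomputable section

section Formal

variable {A B : Type*} [CommRing A] [CommRing B]

/-- The ring of global functions on the formal spectrum `Spf A` of a ring `A` equipped with its
`I`-adic topology, i.e. the inverse limit of the rings `A / I ^ m`. -/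
abbrev SpfFunctions (I : Ideal A) : Type _ := AdicCompletion I A

/-- The ring of functions on the non-vanishing locus `D(f)` of `f` in `Spf A`, where `A` carries
its `I`-adic topology: the `I`-adic completion `A⟨f⁻¹⟩ = lim (A / I ^ m)[f⁻¹]` of `A[f⁻¹]`. -/
abbrev SpfFunctionsAway (I : Ideal A) (f : A) : Type _ :=
  SpfFunctions (I.map (algebraMap A (Localization.Away f)))

/-- The homomorphism `A / I ^ m → B / J ^ m` induced by `φ : A → B` with `φ(I) ⊆ J`. -/
def quotPow (I : Ideal A) (J : Ideal B) (φ : A →+* B) (h : I.map φ ≤ J) (m : ℕ) :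
    A ⧸ I ^ m →+* B ⧸ J ^ m :=
  Ideal.quotientMap (J ^ m) φ (Ideal.map_le_iff_le_comap.mp
    ((Ideal.map_pow φ I m).le.trans (Ideal.pow_right_mono h m)))

theorem quotPow_compat (I : Ideal A) (J : Ideal B) (φ : A →+* B) (h : I.map φ ≤ J) {m k : ℕ}
    (hle : m ≤ k) :
    (Ideal.Quotient.factorPow J hle).comp
        ((quotPow I J φ h k).comp (AdicCompletion.evalₐ I k : AdicCompletion I A →+* A ⧸ I ^ k)) =
      (quotPow I J φ h m).comp (AdicCompletion.evalₐ I m : AdicCompletion I A →+* A ⧸ I ^ m) := by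
  ext x
  obtain ⟨y, rfl⟩ := AdicCompletion.mk_surjective I A x
  simp only [quotPow, RingHom.comp_apply, RingHom.coe_coe, AdicCompletion.evalₐ_mk,
    Ideal.quotientMap_mk, Ideal.Quotient.factorPow, Ideal.Quotient.factor_mk]
  rw [Ideal.Quotient.eq, ← map_sub]
  refine Ideal.map_le_iff_le_comap.mp
    ((Ideal.map_pow φ I m).le.trans (Ideal.pow_right_mono h m)) ?_
  have hy := y.2 hle
  rw [SModEq.sub_mem, smul_eq_mul, Ideal.mul_top] at hy
  rw [← neg_sub]
  exact neg_mem hy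

/-- The pullback of global functions along the morphism `Spf B → Spf A` of formal spectra that is
induced by a ring homomorphism `φ : A → B` with `φ(I) ⊆ J`. It is the inverse limit of the
homomorphisms `A / I ^ m → B / J ^ m` induced by `φ`. -/
def pullback (I : Ideal A) (J : Ideal B) (φ : A →+* B) (h : I.map φ ≤ J) :
    SpfFunctions I →+* SpfFunctions J :=
  AdicCompletion.liftRingHom J
    (fun m => (quotPow I J φ h m).comp
      (AdicCompletion.evalₐ I m : AdicCompletion I A →+* A ⧸ I ^ m))
    (fun hle => quotPow_compat I J φ h hle)

/-- The restriction of global functions from `Spf A` to the non-vanishing locus of `f`. -/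
def restrict (I : Ideal A) (f : A) : SpfFunctions I →+* SpfFunctionsAway I f :=
  pullback I (I.map (algebraMap A (Localization.Away f))) (algebraMap A (Localization.Away f)) le_rfl

/-- The homomorphism `A[f⁻¹] → B[φ(f)⁻¹]` induced by `φ : A → B` maps the extension of `I` into
the extension of `J` if `φ` maps `I` into `J`. -/
theorem map_awayMap_le (I : Ideal A) (J : Ideal B) (φ : A →+* B) (h : I.map φ ≤ J) (f : A) :
    (I.map (algebraMap A (Localization.Away f))).map (Localization.awayMap φ f) ≤
      J.map (algebraMap B (Localization.Away (φ f))) := by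
  have e : (Localization.awayMap φ f).comp (algebraMap A (Localization.Away f)) =
      (algebraMap B (Localization.Away (φ f))).comp φ := by
    ext x
    simp [Localization.awayMap, IsLocalization.Away.map]
  rw [Ideal.map_map, e, ← Ideal.map_map]
  exact Ideal.map_mono h

/-- The pullback of functions from the non-vanishing locus of `f` in `Spf A` to the non-vanishing
locus of `φ(f)` in `Spf B`, the latter being the preimage of the former under the morphism
`Spf B → Spf A` induced by `φ`. -/
def pullbackAway (I : Ideal A) (J : Ideal B) (φ : A →+* B) (h : I.map φ ≤ J) (f : A) :
    SpfFunctionsAway I f →+* SpfFunctionsAway J (φ f) :=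
  pullback _ _ (Localization.awayMap φ f) (map_awayMap_le I J φ h f)

/-- The affine blowup algebra `A[I / a]`: the coordinate ring of the affine open part of the
blowup of `Spec A` in `I` where the pullback of `I` is generated by `a ∈ I`. It is the
`A`-subalgebra of `A[a⁻¹]` that is generated by the fractions `x / a` with `x ∈ I`. -/
def blowupChart (I : Ideal A) (a : A) : Subalgebra A (Localization.Away a) :=
  Algebra.adjoin A
    {y | ∃ x ∈ I, y = IsLocalization.mk' (Localization.Away a) x
      (⟨a, Submonoid.mem_powers a⟩ : Submonoid.powers a)}

/-- The ring of functions on the affine open part of the formal blowup of `Spf A` in `I` where the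
pullback of `I` is generated by `a ∈ I`; here `A` carries its `𝔞`-adic topology. Formal blowups of
`Spf A` being the formal completions of the blowups of `Spec A` along an ideal of definition, it
is the `𝔞`-adic completion of `A[I / a]`. -/
abbrev FormalBlowupChart (𝔞 I : Ideal A) (a : A) : Type _ :=
  SpfFunctions (𝔞.map (algebraMap A (blowupChart I a)))

end Formal

section Disc

variable (R : Type*) [CommRing R] (n : ℕ)

/-- The ring `R[[S₁, …, Sₙ, Z]] = R[[S₁, …, Sₙ]][[Z]]` of functions on the `n + 1`-dimensional
open formal unit disc `𝔛` over `R`. -/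
abbrev Disc : Type _ := PowerSeries (MvPowerSeries (Fin n) R)

variable {R}

/-- The coordinate function `Sᵢ`. -/
def coordS (i : Fin n) : Disc R n := PowerSeries.C (MvPowerSeries.X i)

/-- The coordinate function `Z`. -/
def coordZ : Disc R n := PowerSeries.X

/-- The constant function `c`. -/
def const (c : R) : Disc R n := PowerSeries.C (MvPowerSeries.C c)

variable {n}

/-- `f` is `Z`-distinguished if its reduction in `k[[Z]]`, obtained by setting all `Sᵢ` equal to
zero and by reducing coefficients to the residue field `k` of `R`, is a nonzero non-unit. -/
def IsZDistinguished [IsLocalRing R] (f : Disc R n) : Prop :=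
  PowerSeries.map ((IsLocalRing.residue R).comp MvPowerSeries.constantCoeff) f ≠ 0 ∧
    ¬ IsUnit (PowerSeries.map ((IsLocalRing.residue R).comp MvPowerSeries.constantCoeff) f)

variable (n)

/-- The ideal of definition `(π, S₁, …, Sₙ, Z)` of `R[[S₁, …, Sₙ, Z]]`. -/
def definingIdeal (π : R) : Ideal (Disc R n) :=
  Ideal.span ({const n π, coordZ n} ∪ Set.range (coordS n))

/-- The ideal `(π ^ (r + 1), S₁, …, Sₙ)` of `R[[S₁, …, Sₙ, Z]]`, the centre of the blowup. -/
def centre (π : R) (r : ℕ) : Ideal (Disc R n) :=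
  Ideal.span ({const n (π ^ (r + 1))} ∪ Set.range (coordS n))

/-- The ring of functions on the affine part `𝔛'` of the admissible formal blowup of `𝔛` in
`(π ^ (r + 1), S₁, …, Sₙ)` where the pullback ideal is generated by `π ^ (r + 1)`. -/
abbrev Chart (π : R) (r : ℕ) : Type _ :=
  FormalBlowupChart (definingIdeal n π) (centre n π r) (const n (π ^ (r + 1)))

/-- The structure homomorphism from functions on `𝔛` to functions on `𝔛'`. -/
def toChart (π : R) (r : ℕ) : Disc R n →+* Chart n π r :=
  algebraMap (Disc R n) (Chart n π r)

/-- The ideal generated by `π` in the ring of functions on `𝔛`; it defines the `π`-adic topology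
and hence the envelope `𝔛_π`. -/
def piIdeal (π : R) : Ideal (Disc R n) := Ideal.span {const n π}

/-- The ideal generated by `π` in the ring of functions on `𝔛'`; it defines the `π`-adic topology
and hence the envelope `(𝔛')_π`. -/
def piIdealChart (π : R) (r : ℕ) : Ideal (Chart n π r) := Ideal.span {toChart n π r (const n π)}

theorem map_piIdeal_le (π : R) (r : ℕ) :
    (piIdeal n π).map (toChart n π r) ≤ piIdealChart n π r := by
  rw [piIdeal, piIdealChart, Ideal.map_span, Set.image_singleton]

variable {n}

/-- The ring of global functions on the envelope `𝔛_π`. -/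
abbrev EnvFunctions (n : ℕ) (π : R) : Type _ := SpfFunctions (piIdeal n π)

/-- The ring of global functions on the non-vanishing locus `𝔛_{π,f}` of `f` on `𝔛_π`. -/
abbrev EnvFunctionsAway (π : R) (f : Disc R n) : Type _ := SpfFunctionsAway (piIdeal n π) f

/-- The ring of global functions on the envelope `(𝔛')_π`. -/
abbrev EnvChartFunctions (n : ℕ) (π : R) (r : ℕ) : Type _ := SpfFunctions (piIdealChart n π r)

/-- The ring of global functions on `(𝔛')_{π,f}`, the non-vanishing locus of the pullback of `f`
on `(𝔛')_π`. -/
abbrev EnvChartFunctionsAway (π : R) (r : ℕ) (f : Disc R n) : Type _ :=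
  SpfFunctionsAway (piIdealChart n π r) (toChart n π r f)

/-- Pullback along the open immersion `𝔛_{π,f} ↪ 𝔛_π`. -/
def resEnv (π : R) (f : Disc R n) : EnvFunctions n π →+* EnvFunctionsAway π f :=
  restrict (piIdeal n π) f

/-- Pullback along the open immersion `(𝔛')_{π,f} ↪ (𝔛')_π`. -/
def resChart (π : R) (r : ℕ) (f : Disc R n) :
    EnvChartFunctions n π r →+* EnvChartFunctionsAway π r f :=
  restrict (piIdealChart n π r) (toChart n π r f)

/-- Pullback along the morphism of envelopes `(𝔛')_π → 𝔛_π`. -/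
def pullEnv (n : ℕ) (π : R) (r : ℕ) : EnvFunctions n π →+* EnvChartFunctions n π r :=
  pullback (piIdeal n π) (piIdealChart n π r) (toChart n π r) (map_piIdeal_le n π r)

/-- Pullback along the induced morphism `(𝔛')_{π,f} → 𝔛_{π,f}`. -/
def pullEnvAway (π : R) (r : ℕ) (f : Disc R n) :
    EnvFunctionsAway π f →+* EnvChartFunctionsAway π r f :=
  pullbackAway (piIdeal n π) (piIdealChart n π r) (toChart n π r) (map_piIdeal_le n π r) f

end Disc

end

end FormalHartogs

namespace FormalHartogs

open Ideal

/-! ### Adic completions via sequences of representatives, and clearing denominators -/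

section Adic

variable {A B : Type*} [CommRing A] [CommRing B]

/-! Put `c = π ^ (r + 1)` and let `φ` be the substitution `Sᵢ ↦ c * Tᵢ`. The chart maps to `R[[T,
Z]]` compatibly with `φ`, and divisibility by `π ^ N` is detected there (`exists_chart_lift`), so
everything becomes a question about coefficients of power series.

Since `f` is `Z`-distinguished and `π` divides `c`, `φ f` is a unit times a power of `Z` modulo `π`.
Hence some `φ (f * q)` is a power of `Z` modulo `π ^ N` (`IsZDistinguished.exists_rescaleHom_mul`).
Multiplying by `Z` only shifts coefficients, so `φ f` can be cancelled modulo `π ^ N`, and dividing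
by `φ f` amounts to multiplying by `φ q`, which stays in the image of `φ`.

Let `e` be the image of `h` in `R[[T, Z]]`. Modulo each `π ^ N` it is a fraction `φ a / φ f ^ j`
coming from `g`, so its coefficient at `T ^ α` is divisible by `c ^ |α|` modulo `π ^ N`. Taking `N =
(r + 1) * |α|` makes this exact, so `e = φ u`. Then `u` pulls back to `h` by detection, and to `g`
by comparing coefficients at a precision increased by `(r + 1) * |α|`
(`IsZDistinguished.pow_dvd_discCoeff`). Uniqueness is the injectivity of `φ`. -/

theorem exists_adicSequence (I : Ideal A) (x : AdicCompletion I A) :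
    ∃ s : ℕ → A, (∀ m, AdicCompletion.evalₐ I m x = Ideal.Quotient.mk (I ^ m) (s m)) ∧
      ∀ m k, m ≤ k → s k - s m ∈ I ^ m := by
  obtain ⟨y, rfl⟩ := AdicCompletion.mk_surjective I A x
  refine ⟨y.1, fun m => AdicCompletion.evalₐ_mk I m y, fun m k hmk => ?_⟩
  have hy := y.2 hmk
  rw [SModEq.sub_mem, smul_eq_mul, Ideal.mul_top] at hy
  rw [← neg_sub]
  exact neg_mem hy

theorem exists_adicCompletion (I : Ideal A) (s : ℕ → A) (hs : ∀ m, s (m + 1) - s m ∈ I ^ m) :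
    ∃ x : AdicCompletion I A,
      ∀ m, AdicCompletion.evalₐ I m x = Ideal.Quotient.mk (I ^ m) (s m) := by
  refine ⟨AdicCompletion.mk I A (AdicCompletion.AdicCauchySequence.mk I A s fun m => ?_),
    fun m => AdicCompletion.evalₐ_mk I m _⟩
  rw [SModEq.sub_mem, smul_eq_mul, Ideal.mul_top, ← neg_sub]
  exact neg_mem (hs m)

theorem evalₐ_pullback (I : Ideal A) (J : Ideal B) (φ : A →+* B) (h : I.map φ ≤ J) (m : ℕ)
    (x : SpfFunctions I) (a : A)
    (hx : AdicCompletion.evalₐ I m x = Ideal.Quotient.mk (I ^ m) a) :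
    AdicCompletion.evalₐ J m (pullback I J φ h x) = Ideal.Quotient.mk (J ^ m) (φ a) := by
  rw [pullback, AdicCompletion.evalₐ_liftRingHom, RingHom.comp_apply, RingHom.coe_coe, hx,
    quotPow, Ideal.quotientMap_mk]

/-- Completeness in terms of sequences of elements. -/
theorem isAdicComplete_of_sequences (I : Ideal A)
    (hsep : ∀ x, (∀ m, x ∈ I ^ m) → x = 0)
    (hlim : ∀ s : ℕ → A, (∀ m k, m ≤ k → s k - s m ∈ I ^ m) → ∃ x, ∀ m, x - s m ∈ I ^ m) :
    IsAdicComplete I A := by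
  have key : ∀ (x y : A) (m : ℕ), x ≡ y [SMOD (I ^ m • ⊤ : Ideal A)] ↔ y - x ∈ I ^ m := by
    intro x y m
    rw [SModEq.sub_mem, smul_eq_mul, Ideal.mul_top, ← neg_sub, neg_mem_iff]
  refine { haus' := fun x hx => hsep x fun m => ?_, prec' := fun s hs => ?_ }
  · have := (key x 0 m).1 (hx m)
    rwa [zero_sub, neg_mem_iff] at this
  · obtain ⟨x, hx⟩ := hlim s fun m k hmk => (key _ _ m).1 (hs hmk)
    exact ⟨x, fun m => (key _ _ m).2 (hx m)⟩

theorem exists_sub_mem_of_complete {I : Ideal A} (hI : IsAdicComplete I A) (s : ℕ → A)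
    (hs : ∀ m k, m ≤ k → s k - s m ∈ I ^ m) : ∃ x, ∀ m, x - s m ∈ I ^ m := by
  have key : ∀ (x y : A) (m : ℕ), x ≡ y [SMOD (I ^ m • ⊤ : Ideal A)] ↔ y - x ∈ I ^ m := by
    intro x y m
    rw [SModEq.sub_mem, smul_eq_mul, Ideal.mul_top, ← neg_sub, neg_mem_iff]
  obtain ⟨x, hx⟩ := hI.toIsPrecomplete.prec (f := s) fun {m k} hmk => (key _ _ m).2 (hs m k hmk)
  exact ⟨x, fun m => (key _ _ m).1 (hx m)⟩

theorem mem_span_singleton_pow {a x : A} {m : ℕ} : x ∈ Ideal.span {a} ^ m ↔ a ^ m ∣ x := by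
  rw [Ideal.span_singleton_pow, Ideal.mem_span_singleton]

theorem mem_map_span_singleton_pow (φ : A →+* B) {a : A} {x : B} {m : ℕ} :
    x ∈ (Ideal.span {a}).map φ ^ m ↔ φ a ^ m ∣ x := by
  rw [Ideal.map_span, Set.image_singleton, mem_span_singleton_pow]

theorem exists_of_dvd_away {f p a : A}
    (h : algebraMap A (Localization.Away f) p ∣ algebraMap A (Localization.Away f) a) :
    ∃ (t : ℕ) (b : A), f ^ t * a = p * b := by
  obtain ⟨z, hz⟩ := h
  obtain ⟨j, b, hb⟩ := IsLocalization.Away.surj f z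
  have : algebraMap A (Localization.Away f) (f ^ j * a) =
      algebraMap A (Localization.Away f) (p * b) := by
    rw [map_mul, map_mul, ← hb, hz, map_pow]
    ring
  obtain ⟨t, ht⟩ := IsLocalization.Away.exists_of_eq f this
  exact ⟨t + j, f ^ t * b, by linear_combination ht⟩

theorem awayMap_algebraMap (φ : A →+* B) (f a : A) :
    Localization.awayMap φ f (algebraMap A (Localization.Away f) a) =
      algebraMap B (Localization.Away (φ f)) (φ a) := by
  simp [Localization.awayMap, IsLocalization.Away.map]

theorem exists_of_dvd_awayMap_sub (φ : A →+* B) {f a : A} {y : Localization.Away f} {j : ℕ}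
    (hy : y * algebraMap A (Localization.Away f) f ^ j = algebraMap A (Localization.Away f) a)
    {p x : B}
    (h : algebraMap B (Localization.Away (φ f)) p ∣
      Localization.awayMap φ f y - algebraMap B (Localization.Away (φ f)) x) :
    ∃ (t : ℕ) (b : B), φ f ^ t * (φ a - φ f ^ j * x) = p * b := by
  apply exists_of_dvd_away
  have e := congrArg (Localization.awayMap φ f) hy
  rw [map_mul, map_pow, awayMap_algebraMap, awayMap_algebraMap] at e
  rw [map_sub, map_mul, map_pow, ← e]
  exact (h.mul_right (algebraMap B (Localization.Away (φ f)) (φ f) ^ j)).trans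
    (dvd_of_eq (by ring))

end Adic

/-! ### Coefficients, rescaling and completeness of the power series ring -/

section Disc

variable {R : Type*} [CommRing R] {n : ℕ}

/-- The coefficient of `S ^ α * Z ^ i`. -/
noncomputable def discCoeff (i : ℕ) (α : Fin n →₀ ℕ) : Disc R n →+ R :=
  (MvPowerSeries.coeff α).toAddMonoidHom.comp (PowerSeries.coeff i).toAddMonoidHom

theorem discCoeff_apply (i : ℕ) (α : Fin n →₀ ℕ) (a : Disc R n) :
    discCoeff i α a = MvPowerSeries.coeff α (PowerSeries.coeff i a) := rfl

theorem disc_ext {a b : Disc R n} (h : ∀ i α, discCoeff i α a = discCoeff i α b) : a = b := by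
  ext i α
  exact h i α

/-- The power series with given coefficients. -/
noncomputable def discMk (c : ℕ → (Fin n →₀ ℕ) → R) : Disc R n :=
  PowerSeries.mk fun i => (c i : MvPowerSeries (Fin n) R)

@[simp] theorem discCoeff_discMk (c : ℕ → (Fin n →₀ ℕ) → R) (i : ℕ) (α : Fin n →₀ ℕ) :
    discCoeff i α (discMk c) = c i α :=
  congrFun (PowerSeries.coeff_mk (R := MvPowerSeries (Fin n) R) i c) α

theorem const_pow (c : R) (N : ℕ) : const n (c ^ N) = const n c ^ N := by
  simp [const]

@[simp] theorem discCoeff_const_mul (c : R) (a : Disc R n) (i : ℕ) (α : Fin n →₀ ℕ) :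
    discCoeff i α (const n c * a) = c * discCoeff i α a := by
  simp [discCoeff_apply, const]

@[simp] theorem discCoeff_const_pow_mul (c : R) (N : ℕ) (a : Disc R n) (i : ℕ) (α : Fin n →₀ ℕ) :
    discCoeff i α (const n c ^ N * a) = c ^ N * discCoeff i α a := by
  rw [← const_pow, discCoeff_const_mul]

@[simp] theorem discCoeff_coordZ_pow_mul (l : ℕ) (a : Disc R n) (i : ℕ) (α : Fin n →₀ ℕ) :
    discCoeff (i + l) α (coordZ n ^ l * a) = discCoeff i α a := by
  rw [discCoeff_apply, coordZ, PowerSeries.coeff_X_pow_mul, discCoeff_apply]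

theorem discCoeff_coordZ_pow_mul_of_lt {i l : ℕ} (h : i < l) (a : Disc R n) (α : Fin n →₀ ℕ) :
    discCoeff i α (coordZ n ^ l * a) = 0 := by
  rw [discCoeff_apply, coordZ, PowerSeries.coeff_X_pow_mul', if_neg (by omega), map_zero]

theorem const_dvd_iff {c : R} {a : Disc R n} :
    const n c ∣ a ↔ ∀ i α, c ∣ discCoeff i α a := by
  constructor
  · rintro ⟨b, rfl⟩ i α
    exact ⟨_, discCoeff_const_mul c b i α⟩
  · intro h
    choose b hb using h
    exact ⟨discMk b, disc_ext fun i α => by rw [discCoeff_const_mul, discCoeff_discMk, hb]⟩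

theorem const_pow_dvd_iff {c : R} {N : ℕ} {a : Disc R n} :
    const n c ^ N ∣ a ↔ ∀ i α, c ^ N ∣ discCoeff i α a := by
  rw [← const_pow, const_dvd_iff]

/-- The substitution `Sᵢ ↦ c * Tᵢ`. -/
noncomputable def rescaleHom (n : ℕ) (c : R) : Disc R n →+* Disc R n :=
  PowerSeries.map (MvPowerSeries.rescale fun _ => c)

theorem discCoeff_rescaleHom (c : R) (a : Disc R n) (i : ℕ) (α : Fin n →₀ ℕ) :
    discCoeff i α (rescaleHom n c a) = c ^ α.degree * discCoeff i α a := by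
  rw [discCoeff_apply, rescaleHom, PowerSeries.coeff_map, MvPowerSeries.coeff_rescale,
    discCoeff_apply, Finsupp.prod, Finset.prod_pow_eq_pow_sum, Finsupp.degree_apply]

theorem rescaleHom_coordZ (c : R) : rescaleHom n c (coordZ n) = coordZ n := by
  simp [rescaleHom, coordZ]

theorem rescaleHom_const (c d : R) : rescaleHom n c (const n d) = const n d := by
  classical
  refine disc_ext fun i α => ?_
  rw [discCoeff_rescaleHom]
  simp only [discCoeff_apply, const, PowerSeries.coeff_C]
  split_ifs
  · by_cases h : α = 0 <;> simp [MvPowerSeries.coeff_C, h]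
  · simp

theorem rescaleHom_coordS (c : R) (s : Fin n) :
    rescaleHom n c (coordS n s) = const n c * coordS n s := by
  refine disc_ext fun i α => ?_
  rw [discCoeff_rescaleHom, discCoeff_const_mul]
  simp only [discCoeff_apply, coordS, PowerSeries.coeff_C]
  classical
  split_ifs
  · by_cases h : α = Finsupp.single s 1 <;> simp [MvPowerSeries.coeff_X, h]
  · simp

/-- The weight `w` treats two topologies at once: `w = 0` is the `π`-adic one and `w = id` the `(π,
Z)`-adic one. Limits are taken coefficientwise, along the sequence shifted by `w i`. -/
theorem exists_forall_pow_dvd_discCoeff_sub {π : R} (hc : IsAdicComplete (Ideal.span {π}) R) (w : ℕ → ℕ)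
    (s : ℕ → Disc R n)
    (hs : ∀ m k, m ≤ k → ∀ i α, π ^ (m - w i) ∣ discCoeff i α (s k - s m)) :
    ∃ x, ∀ m i α, π ^ (m - w i) ∣ discCoeff i α (x - s m) := by
  have : ∀ i α, ∃ c : R, ∀ m, c - discCoeff i α (s (m + w i)) ∈ Ideal.span {π} ^ m := by
    intro i α
    refine exists_sub_mem_of_complete hc (fun m => discCoeff i α (s (m + w i))) ?_
    intro m k hmk
    have := hs (m + w i) (k + w i) (by omega) i α
    rw [mem_span_singleton_pow, ← map_sub]
    simpa using this
  choose c hcc using this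
  refine ⟨discMk c, fun m i α => ?_⟩
  rcases le_total m (w i) with h | h
  · rw [Nat.sub_eq_zero_of_le h, pow_zero]
    exact one_dvd _
  · have := mem_span_singleton_pow.1 (hcc i α (m - w i))
    rw [Nat.sub_add_cancel h] at this
    rwa [map_sub, discCoeff_discMk]

theorem eq_zero_of_forall_pow_dvd {π : R} (hc : IsAdicComplete (Ideal.span {π}) R) {c : R}
    (h : ∀ m, π ^ m ∣ c) : c = 0 := by
  refine hc.toIsHausdorff.haus c fun m => ?_
  rw [SModEq.zero, smul_eq_mul, Ideal.mul_top, mem_span_singleton_pow]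
  exact h m

theorem isAdicComplete_piIdeal {π : R} (hc : IsAdicComplete (Ideal.span {π}) R) :
    IsAdicComplete (piIdeal n π) (Disc R n) := by
  refine isAdicComplete_of_sequences _ (fun x hx => disc_ext fun i α => ?_) fun s hs => ?_
  · rw [map_zero]
    refine eq_zero_of_forall_pow_dvd hc fun m => ?_
    exact const_pow_dvd_iff.1 (mem_span_singleton_pow.1 (hx m)) i α
  · obtain ⟨x, hx⟩ := exists_forall_pow_dvd_discCoeff_sub hc (fun _ => 0) s fun m k hmk i α =>
      const_pow_dvd_iff.1 (mem_span_singleton_pow.1 (hs m k hmk)) i α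
    exact ⟨x, fun m => mem_span_singleton_pow.2 (const_pow_dvd_iff.2 (hx m))⟩

/-- The ideal `(π, Z)`. -/
noncomputable def piZIdeal (n : ℕ) (π : R) : Ideal (Disc R n) := Ideal.span {const n π, coordZ n}

/-- The `k`-th power is generated by the products `π ^ (k - i) * Z ^ i`; the truncated subtraction
leaves coefficients with `i ≥ k` unconstrained. -/
theorem mem_piZIdeal_pow {π : R} {k : ℕ} {e : Disc R n} :
    e ∈ piZIdeal n π ^ k ↔ ∀ i α, π ^ (k - i) ∣ discCoeff i α e := by
  constructor
  · induction k generalizing e with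
    | zero => intro _ i α; simp
    | succ k ih =>
      intro he i α
      rw [pow_succ'] at he
      refine Submodule.mul_induction_on he ?_ ?_
      · intro x hx y hy
        obtain ⟨a, b, rfl⟩ := Ideal.mem_span_pair.1 hx
        have e1 : (a * const n π + b * coordZ n) * y =
            const n π * (a * y) + coordZ n ^ 1 * (b * y) := by ring
        rw [e1, map_add]
        refine dvd_add ?_ ?_
        · rw [discCoeff_const_mul]
          refine (pow_dvd_pow π (show k + 1 - i ≤ k - i + 1 by omega)).trans ?_
          rw [pow_succ']
          exact mul_dvd_mul_left _ (ih (Ideal.mul_mem_left _ _ hy) i α)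
        · rcases i with _ | i
          · rw [discCoeff_coordZ_pow_mul_of_lt (by omega)]
            exact dvd_zero _
          · rw [discCoeff_coordZ_pow_mul, Nat.add_sub_add_right]
            exact ih (Ideal.mul_mem_left _ _ hy) i α
      · intro x y hx hy
        rw [map_add]
        exact dvd_add hx hy
  · intro h
    have hz : (coordZ n : Disc R n) ∈ piZIdeal n π := Ideal.subset_span (by simp)
    have hp : const n π ∈ piZIdeal n π := Ideal.subset_span (by simp)
    choose c hcc using h
    -- Split off the tail divisible by `Z ^ k`; each lower slice `Z ^ j` carries the factor `π ^ (k
    -- - j)`.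
    have key : e = coordZ n ^ k * discMk (fun i α => discCoeff (i + k) α e) +
        ∑ j ∈ Finset.range k, coordZ n ^ j * (const n π ^ (k - j) *
          discMk (fun i α => if i = 0 then c j α else 0)) := by
      refine disc_ext fun i α => ?_
      have hterm : ∀ j, discCoeff i α (coordZ n ^ j * (const n π ^ (k - j) *
          discMk (fun i α => if i = 0 then c j α else 0))) =
          if i = j then π ^ (k - j) * c j α else 0 := by
        intro j
        rcases lt_or_ge i j with hij | hij
        · rw [discCoeff_coordZ_pow_mul_of_lt hij, if_neg (by omega)]
        · obtain ⟨l, rfl⟩ := Nat.exists_eq_add_of_le' hij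
          rw [discCoeff_coordZ_pow_mul, discCoeff_const_pow_mul, discCoeff_discMk]
          by_cases hl : l = 0
          · simp [hl]
          · rw [if_neg hl, if_neg (by omega), mul_zero]
      rw [map_add, map_sum, Finset.sum_congr rfl fun j _ => hterm j, Finset.sum_ite_eq]
      rcases lt_or_ge i k with hik | hik
      · rw [discCoeff_coordZ_pow_mul_of_lt hik, if_pos (Finset.mem_range.2 hik), zero_add, hcc]
      · obtain ⟨l, rfl⟩ := Nat.exists_eq_add_of_le' hik
        rw [discCoeff_coordZ_pow_mul, if_neg (by simp), add_zero, discCoeff_discMk]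
    rw [key]
    refine add_mem (Ideal.mul_mem_right _ _ (Ideal.pow_mem_pow hz k)) (sum_mem fun j hj => ?_)
    rw [← mul_assoc]
    refine Ideal.mul_mem_right _ _ ?_
    have := Ideal.mul_mem_mul (Ideal.pow_mem_pow hz j) (Ideal.pow_mem_pow hp (k - j))
    rwa [← pow_add, Nat.add_sub_cancel' (Finset.mem_range.1 hj).le] at this

theorem isAdicComplete_piZIdeal {π : R} (hc : IsAdicComplete (Ideal.span {π}) R) :
    IsAdicComplete (piZIdeal n π) (Disc R n) := by
  refine isAdicComplete_of_sequences _ (fun x hx => disc_ext fun i α => ?_) fun s hs => ?_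
  · rw [map_zero]
    refine eq_zero_of_forall_pow_dvd hc fun m => ?_
    simpa using mem_piZIdeal_pow.1 (hx (m + i)) i α
  · obtain ⟨x, hx⟩ := exists_forall_pow_dvd_discCoeff_sub hc id s fun m k hmk i α =>
      mem_piZIdeal_pow.1 (hs m k hmk) i α
    exact ⟨x, fun m => mem_piZIdeal_pow.2 (hx m)⟩

end Disc

/-! ### Weierstrass-type properties of distinguished series -/

section Distinguished

variable {R : Type*} [CommRing R] [IsLocalRing R] {n : ℕ}

theorem residue_discCoeff (f : Disc R n) (i : ℕ) :
    PowerSeries.coeff i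
      (PowerSeries.map ((IsLocalRing.residue R).comp MvPowerSeries.constantCoeff) f) =
      IsLocalRing.residue R (discCoeff i 0 f) := by
  rw [PowerSeries.coeff_map, RingHom.comp_apply, discCoeff_apply,
    MvPowerSeries.coeff_zero_eq_constantCoeff_apply]

/-- A `Z`-distinguished power series is the sum of a unit times a power of `Z` and of a power
series all of whose coefficients lie in the ideal `(π, S₁, …, Sₙ)`. -/
theorem IsZDistinguished.exists_eq_add {f : Disc R n} (hf : IsZDistinguished f) :
    ∃ (d : ℕ) (v w : Disc R n), IsUnit v ∧ f = coordZ n ^ d * v + w ∧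
      ∀ i, discCoeff i 0 w ∈ IsLocalRing.maximalIdeal R := by
  classical
  have hne : ∃ i, IsLocalRing.residue R (discCoeff i 0 f) ≠ 0 := by
    by_contra! h
    refine hf.1 (PowerSeries.ext fun i => ?_)
    rw [residue_discCoeff, h i, map_zero]
  -- The exponent is the `Z`-order of the reduction of `f`; `v` is the shifted tail and `w` the
  -- truncation below that order.
  refine ⟨Nat.find hne, PowerSeries.mk fun i => PowerSeries.coeff (i + Nat.find hne) f,
    (PowerSeries.trunc (Nat.find hne) f : Polynomial (MvPowerSeries (Fin n) R)), ?_,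
    PowerSeries.eq_X_pow_mul_shift_add_trunc _ f, fun i => ?_⟩
  · rw [PowerSeries.isUnit_iff_constantCoeff, ← PowerSeries.coeff_zero_eq_constantCoeff_apply,
      PowerSeries.coeff_mk, MvPowerSeries.isUnit_iff_constantCoeff, zero_add,
      ← MvPowerSeries.coeff_zero_eq_constantCoeff_apply]
    exact (IsLocalRing.residue_ne_zero_iff_isUnit _).1 (Nat.find_spec hne)
  · rw [discCoeff_apply, Polynomial.coeff_coe, PowerSeries.coeff_trunc]
    split_ifs with hi
    · rw [← IsLocalRing.residue_eq_zero_iff]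
      exact not_not.1 (Nat.find_min hne hi)
    · rw [map_zero]
      exact zero_mem _

/-- After the substitution `Sᵢ ↦ c * Tᵢ` with `π ∣ c` a `Z`-distinguished power series divides a
power of `Z` modulo any power of `π`, and the cofactor is in the image of the substitution. -/
theorem IsZDistinguished.exists_rescaleHom_mul {f : Disc R n} (hf : IsZDistinguished f) {π : R}
    (hπ : IsLocalRing.maximalIdeal R = Ideal.span {π}) {c : R} (hc : π ∣ c) (N : ℕ) :
    ∃ (l : ℕ) (q e : Disc R n),
      rescaleHom n c (f * q) = coordZ n ^ l + const n π ^ N * e := by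
  obtain ⟨d, v, w, hv, rfl, hw⟩ := hf.exists_eq_add
  obtain ⟨v', hv'⟩ := hv.exists_right_inv
  -- Coefficients at `α = 0` lie in the maximal ideal; all others acquire a factor `c`.
  have hdvd : const n π ∣ rescaleHom n c w := by
    refine const_dvd_iff.2 fun i α => ?_
    rw [discCoeff_rescaleHom]
    by_cases hα : α = 0
    · subst hα
      refine Dvd.dvd.mul_left ?_ _
      rw [← Ideal.mem_span_singleton, ← hπ]
      exact hw i
    · refine Dvd.dvd.mul_right (hc.trans (dvd_pow_self c ?_)) _
      rwa [Ne, Finsupp.degree_eq_zero_iff]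
  obtain ⟨w', hw'⟩ := hdvd
  -- `f = Z ^ d * v - (-w)` divides the difference of `N`-th powers, whose second term is divisible
  -- by `π ^ N` after rescaling.
  obtain ⟨q, hq⟩ := sub_dvd_pow_sub_pow (coordZ n ^ d * v) (-w) N
  have e1 : (coordZ n ^ d * v + w) * (q * v' ^ N) =
      coordZ n ^ (d * N) + (-(w ^ N * (-1) ^ N * v' ^ N)) := by
    rw [← mul_assoc, ← sub_neg_eq_add, ← hq, neg_pow w N, mul_pow, ← pow_mul]
    have : v ^ N * v' ^ N = 1 := by rw [← mul_pow, hv', one_pow]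
    linear_combination coordZ n ^ (d * N) * this
  refine ⟨d * N, q * v' ^ N, rescaleHom n c (-((-1) ^ N * v' ^ N)) * w' ^ N, ?_⟩
  rw [e1, map_add, map_pow, rescaleHom_coordZ]
  simp only [map_neg, map_mul, map_pow, hw', mul_pow]
  ring

end Distinguished

/-! ### Series without constant term lie in the ideal of the variables -/

section Variables

variable {R : Type*} [CommRing R] {n : ℕ}

theorem mvPowerSeries_mem_span_X {ι : Type*} (s : Finset ι) (b : MvPowerSeries ι R)
    (hb : ∀ m : ι →₀ ℕ, (∀ i ∈ s, m i = 0) → MvPowerSeries.coeff m b = 0) :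
    b ∈ Ideal.span (Set.range (MvPowerSeries.X : ι → MvPowerSeries ι R)) := by
  classical
  induction s using Finset.induction_on generalizing b with
  | empty =>
    have : b = 0 := MvPowerSeries.ext fun m => by simpa using hb m (by simp)
    rw [this]
    exact zero_mem _
  | insert j s hj ih =>
    -- The part of `b` free of `X j`: the remainder is divisible by `X j`, and `b'` meets the
    -- hypothesis for the smaller set.
    let b' : MvPowerSeries ι R := fun m => if m j = 0 then MvPowerSeries.coeff m b else 0
    have hb' : ∀ m, MvPowerSeries.coeff m b' =
        if m j = 0 then MvPowerSeries.coeff m b else 0 := fun m => rfl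
    have h1 : b' ∈ Ideal.span (Set.range (MvPowerSeries.X : ι → MvPowerSeries ι R)) := by
      refine ih b' fun m hm => ?_
      rw [hb']
      split_ifs with h
      · refine hb m fun i hi => ?_
        rcases Finset.mem_insert.1 hi with rfl | hi
        exacts [h, hm i hi]
      · rfl
    have h2 : MvPowerSeries.X j ∣ b - b' := by
      rw [MvPowerSeries.X_dvd_iff]
      intro m hm
      rw [map_sub, hb', if_pos hm, sub_self]
    rw [← sub_add_cancel b b']
    refine add_mem ?_ h1
    exact Ideal.mem_of_dvd _ h2 (Ideal.subset_span ⟨j, rfl⟩)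

theorem sub_const_mem_span (a : Disc R n) :
    a - const n (discCoeff 0 0 a) ∈ Ideal.span ({coordZ n} ∪ Set.range (coordS n)) := by
  have h1 : a - PowerSeries.C (PowerSeries.constantCoeff a) ∈
      Ideal.span ({coordZ n} ∪ Set.range (coordS n)) := by
    rw [PowerSeries.sub_const_eq_X_mul_shift]
    exact Ideal.mul_mem_right _ _ (Ideal.subset_span (Or.inl rfl))
  have h2 := mvPowerSeries_mem_span_X (R := R) (Finset.univ : Finset (Fin n))
    (PowerSeries.constantCoeff a - MvPowerSeries.C (discCoeff 0 0 a)) (by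
      intro m hm
      have : m = 0 := Finsupp.ext fun i => hm i (Finset.mem_univ i)
      subst this
      rw [map_sub, discCoeff_apply, PowerSeries.coeff_zero_eq_constantCoeff_apply]
      simp)
  have h3 := Ideal.mem_map_of_mem
    (PowerSeries.C : MvPowerSeries (Fin n) R →+* Disc R n) h2
  rw [Ideal.map_span, ← Set.range_comp, map_sub] at h3
  have h4 := add_mem h1 (Ideal.span_mono Set.subset_union_right h3)
  rwa [sub_add_sub_cancel] at h4

end Variables

/-! ### Homomorphisms out of the affine blowup algebra -/

section Lift

variable {A E : Type*} [CommRing A] [CommRing E]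

/-- The universal property of the affine blowup algebra for homomorphisms to rings on which the
image of `a` is a nonzerodivisor that divides the image of `I`. -/
theorem exists_blowupChart_lift (I : Ideal A) (a : A) (φ : A →+* E)
    (ha : φ a ∈ nonZeroDivisors E) (hI : ∀ x ∈ I, φ a ∣ φ x) :
    ∃ ψ : blowupChart I a →+* E, ∀ x, ψ (algebraMap A (blowupChart I a) x) = φ x := by
  let ι := algebraMap E (Localization.Away (φ a))
  have hι : Function.Injective ι :=
    IsLocalization.injective (M := Submonoid.powers (φ a)) _
      ((Submonoid.powers_le (P := nonZeroDivisors E)).2 ha)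
  have hrange : ∀ y : blowupChart I a, Localization.awayMap φ a y ∈ ι.range := by
    rintro ⟨y, hy⟩
    change Localization.awayMap φ a y ∈ ι.range
    induction hy using Algebra.adjoin_induction with
    | mem y hy =>
      obtain ⟨x, hx, rfl⟩ := hy
      obtain ⟨z, hz⟩ := hI x hx
      refine ⟨z, ?_⟩
      have h1 := congrArg (Localization.awayMap φ a) (IsLocalization.mk'_spec
        (Localization.Away a) x (⟨a, Submonoid.mem_powers a⟩ : Submonoid.powers a))
      rw [map_mul, awayMap_algebraMap, awayMap_algebraMap, hz, map_mul, mul_comm] at h1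
      exact ((IsLocalization.Away.algebraMap_isUnit (S := Localization.Away (φ a))
        (φ a)).mul_left_cancel h1).symm
    | algebraMap x => exact ⟨φ x, (awayMap_algebraMap φ a x).symm⟩
    | add x y _ _ hx hy => rw [map_add]; exact add_mem hx hy
    | mul x y _ _ hx hy => rw [map_mul]; exact mul_mem hx hy
  let e : E ≃+* ι.range := RingEquiv.ofBijective ι.rangeRestrict
    ⟨fun x y h => hι (congrArg Subtype.val h), ι.rangeRestrict_surjective⟩
  refine ⟨(e.symm : ι.range →+* E).comp (((Localization.awayMap φ a).comp
    (blowupChart I a).subtype).codRestrict ι.range hrange), fun x => ?_⟩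
  rw [RingHom.comp_apply]
  refine e.symm_apply_eq.2 (Subtype.ext ?_)
  exact awayMap_algebraMap φ a x

theorem exists_mul_eq_of_mem (I : Ideal A) (a : A) {x : A} (hx : x ∈ I) :
    ∃ t : blowupChart I a, (t : Localization.Away a) = IsLocalization.mk' (Localization.Away a) x
      (⟨a, Submonoid.mem_powers a⟩ : Submonoid.powers a) ∧
      algebraMap A (blowupChart I a) a * t = algebraMap A (blowupChart I a) x :=
  ⟨⟨_, Algebra.subset_adjoin ⟨x, hx, rfl⟩⟩, rfl,
    Subtype.ext (IsLocalization.mk'_spec' (Localization.Away a) x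
      (⟨a, Submonoid.mem_powers a⟩ : Submonoid.powers a))⟩

end Lift

/-! ### Mapping the chart to power series in the blowup coordinates -/

section Chart

variable {R : Type*} [CommRing R] {n : ℕ} {π : R} {r : ℕ}

/-- The affine blowup algebra of `R[[S₁, …, Sₙ, Z]]` whose completion is `Chart n π r`. -/
noncomputable abbrev Blowup (n : ℕ) (π : R) (r : ℕ) :=
  blowupChart (centre n π r) (const n (π ^ (r + 1)))

/-- The structure homomorphism of the affine blowup algebra. -/
noncomputable abbrev toBlowup (n : ℕ) (π : R) (r : ℕ) : Disc R n →+* Blowup n π r :=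
  algebraMap (Disc R n) (Blowup n π r)

/-- The extension of the ideal of definition to the affine blowup algebra. -/
noncomputable abbrev blowupIdeal (n : ℕ) (π : R) (r : ℕ) : Ideal (Blowup n π r) :=
  (definingIdeal n π).map (toBlowup n π r)

/-- The inclusion of the constant functions. -/
noncomputable def constHom (R : Type*) [CommRing R] (n : ℕ) : R →+* Disc R n :=
  PowerSeries.C.comp MvPowerSeries.C

theorem constHom_apply (c : R) : constHom R n c = const n c := rfl

theorem exists_blowupCoord (n : ℕ) (π : R) (r : ℕ) : ∃ T : Fin n → Blowup n π r,
    ∀ i, toBlowup n π r (const n (π ^ (r + 1))) * T i = toBlowup n π r (coordS n i) := by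
  have := fun i : Fin n => exists_mul_eq_of_mem (centre n π r) (const n (π ^ (r + 1)))
    (x := coordS n i) (Ideal.subset_span (Or.inr ⟨i, rfl⟩))
  choose T hT using this
  exact ⟨T, fun i => (hT i).2⟩

/-- The homomorphism from `R[T₁, …, Tₙ][Z]` to the affine blowup algebra. -/
noncomputable def evalBlowup (T : Fin n → Blowup n π r) :
    Polynomial (MvPolynomial (Fin n) R) →+* Blowup n π r :=
  Polynomial.eval₂RingHom
    (MvPolynomial.eval₂Hom ((toBlowup n π r).comp (constHom R n)) T)
    (toBlowup n π r (coordZ n))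

theorem evalBlowup_const (T : Fin n → Blowup n π r) (c : R) :
    evalBlowup T (Polynomial.C (MvPolynomial.C c)) = toBlowup n π r (const n c) := by
  simp [evalBlowup, constHom_apply]

theorem evalBlowup_X (T : Fin n → Blowup n π r) :
    evalBlowup T Polynomial.X = toBlowup n π r (coordZ n) := by
  simp [evalBlowup]

theorem evalBlowup_C_X (T : Fin n → Blowup n π r) (i : Fin n) :
    evalBlowup T (Polynomial.C (MvPolynomial.X i)) = T i := by
  simp [evalBlowup]

theorem const_mem_blowupIdeal : toBlowup n π r (const n π) ∈ blowupIdeal n π r :=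
  Ideal.mem_map_of_mem _ (Ideal.subset_span (by simp))

theorem coordZ_mem_blowupIdeal : toBlowup n π r (coordZ n) ∈ blowupIdeal n π r :=
  Ideal.mem_map_of_mem _ (Ideal.subset_span (by simp))

theorem coordS_mem_blowupIdeal (i : Fin n) :
    toBlowup n π r (coordS n i) ∈ blowupIdeal n π r :=
  Ideal.mem_map_of_mem _ (Ideal.subset_span (by simp))

/-- Up to a constant, a series is a combination of `Z` and the `Sᵢ`. Their images are values of
polynomials and lie in the ideal, so approximating the cofactors to order `k` gives order `k + 1`.
-/
theorem exists_evalBlowup_sub_mem_of_disc {T : Fin n → Blowup n π r}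
    (hT : ∀ i, toBlowup n π r (const n (π ^ (r + 1))) * T i = toBlowup n π r (coordS n i))
    (k : ℕ) (a : Disc R n) :
    ∃ p, toBlowup n π r a - evalBlowup T p ∈ blowupIdeal n π r ^ k := by
  induction k generalizing a with
  | zero => exact ⟨0, by simp⟩
  | succ k ih =>
    -- The free multiplier `b` absorbs the scalars in the span induction.
    have key : ∀ x ∈ Ideal.span ({coordZ n} ∪ Set.range (coordS n)), ∀ b : Disc R n,
        ∃ p, toBlowup n π r (b * x) - evalBlowup T p ∈ blowupIdeal n π r ^ (k + 1) := by
      intro x hx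
      induction hx using Submodule.span_induction with
      | mem x hx =>
        intro b
        have hx' : toBlowup n π r x ∈ blowupIdeal n π r ∧
            ∃ q, evalBlowup T q = toBlowup n π r x := by
          rcases hx with rfl | ⟨i, rfl⟩
          · exact ⟨coordZ_mem_blowupIdeal, _, evalBlowup_X T⟩
          · refine ⟨coordS_mem_blowupIdeal i, Polynomial.C (MvPolynomial.C (π ^ (r + 1))) *
              Polynomial.C (MvPolynomial.X i), ?_⟩
            rw [map_mul, evalBlowup_const, evalBlowup_C_X, hT]
        obtain ⟨hxJ, q, hq⟩ := hx'
        obtain ⟨p, hp⟩ := ih b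
        refine ⟨p * q, ?_⟩
        rw [map_mul, map_mul, hq, ← sub_mul, pow_succ (blowupIdeal n π r)]
        exact Ideal.mul_mem_mul hp hxJ
      | zero => exact fun b => ⟨0, by simp⟩
      | add x y _ _ hx hy =>
        intro b
        obtain ⟨p, hp⟩ := hx b
        obtain ⟨q, hq⟩ := hy b
        refine ⟨p + q, ?_⟩
        rw [mul_add, map_add, map_add, add_sub_add_comm]
        exact add_mem hp hq
      | smul c x _ hx =>
        intro b
        rw [smul_eq_mul, ← mul_assoc]
        exact hx (b * c)
    obtain ⟨p, hp⟩ := key _ (sub_const_mem_span a) 1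
    refine ⟨p + Polynomial.C (MvPolynomial.C (discCoeff 0 0 a)), ?_⟩
    rw [one_mul, map_sub] at hp
    rw [map_add, evalBlowup_const, add_comm (evalBlowup T p), ← sub_sub]
    exact hp

/-- Approximable elements form a subring. It contains the images of power series and the `Tᵢ`, hence
all generating fractions. -/
theorem exists_evalBlowup_sub_mem {T : Fin n → Blowup n π r}
    (hT : ∀ i, toBlowup n π r (const n (π ^ (r + 1))) * T i = toBlowup n π r (coordS n i))
    (k : ℕ) (y : Blowup n π r) :
    ∃ p, y - evalBlowup T p ∈ blowupIdeal n π r ^ k := by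
  let J := blowupIdeal n π r ^ k
  let P : Subring (Blowup n π r) :=
    ((Ideal.Quotient.mk J).comp (evalBlowup T)).range.comap (Ideal.Quotient.mk J)
  have hP : ∀ y, y ∈ P ↔ ∃ p, y - evalBlowup T p ∈ J := fun y =>
    exists_congr fun p => by
      rw [RingHom.comp_apply, ← Ideal.Quotient.eq]
      exact eq_comm
  have hdisc : ∀ a, toBlowup n π r a ∈ P := fun a =>
    (hP _).2 (exists_evalBlowup_sub_mem_of_disc hT k a)
  have hTP : ∀ i, T i ∈ P := fun i =>
    (hP _).2 ⟨Polynomial.C (MvPolynomial.X i), by rw [evalBlowup_C_X, sub_self]; exact zero_mem _⟩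
  have hfrac : ∀ x ∈ centre n π r, ∃ t ∈ P,
      toBlowup n π r (const n (π ^ (r + 1))) * t = toBlowup n π r x := by
    intro x hx
    induction hx using Submodule.span_induction with
    | mem x hx =>
      rcases hx with rfl | ⟨i, rfl⟩
      · exact ⟨1, one_mem _, mul_one _⟩
      · exact ⟨T i, hTP i, hT i⟩
    | zero => exact ⟨0, zero_mem _, by simp⟩
    | add x y _ _ hx hy =>
      obtain ⟨s, hs, hs'⟩ := hx
      obtain ⟨t, ht, ht'⟩ := hy
      exact ⟨s + t, add_mem hs ht, by rw [mul_add, hs', ht', map_add]⟩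
    | smul c x _ hx =>
      obtain ⟨s, hs, hs'⟩ := hx
      refine ⟨toBlowup n π r c * s, mul_mem (hdisc c) hs, ?_⟩
      rw [smul_eq_mul, map_mul, ← hs']
      ring
  refine (hP y).1 ?_
  obtain ⟨y, hy⟩ := y
  induction hy using Algebra.adjoin_induction with
  | mem y hy =>
    obtain ⟨x, hx, rfl⟩ := hy
    obtain ⟨t, ht, ht'⟩ := hfrac x hx
    have hval : ∀ z : Blowup n π r, (t : Localization.Away (const n (π ^ (r + 1)))) = z → z ∈ P :=
      fun z hz => (Subtype.ext hz : t = z) ▸ ht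
    refine hval _ (IsLocalization.eq_mk'_iff_mul_eq.2 ?_)
    rw [mul_comm]
    exact congrArg Subtype.val ht'
  | algebraMap a => exact hdisc a
  | add x y _ _ hx hy => exact add_mem hx hy
  | mul x y _ _ hx hy => exact mul_mem hx hy

/-- Monomial by monomial: the coefficient supplies either `π ^ N`, or `π ^ (k - i)`, which together
with `Z ^ i` lies in the `k`-th power of the ideal. -/
theorem evalBlowup_mem {T : Fin n → Blowup n π r} {N k : ℕ}
    {p : Polynomial (MvPolynomial (Fin n) R)}
    (hp : ∀ i α, π ^ min N (k - i) ∣ MvPolynomial.coeff α (p.coeff i)) :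
    evalBlowup T p ∈ Ideal.span {toBlowup n π r (const n π) ^ N} ⊔ blowupIdeal n π r ^ k := by
  rw [p.as_sum_support_C_mul_X_pow, map_sum]
  refine sum_mem fun i _ => ?_
  rw [map_mul, map_pow, evalBlowup_X, (p.coeff i).as_sum, map_sum, map_sum, Finset.sum_mul]
  refine sum_mem fun α _ => ?_
  obtain ⟨c, hc⟩ := hp i α
  have e : MvPolynomial.monomial α (MvPolynomial.coeff α (p.coeff i)) =
      MvPolynomial.C π ^ min N (k - i) * MvPolynomial.monomial α c := by
    rw [hc, ← map_pow, MvPolynomial.C_mul_monomial]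
  rw [e, map_mul, map_mul, map_pow, map_pow, evalBlowup_const]
  rcases le_total N (k - i) with h | h
  · rw [min_eq_left h, mul_assoc]
    exact Ideal.mem_sup_left (Ideal.mul_mem_right _ _ (Ideal.mem_span_singleton_self _))
  · rw [min_eq_right h, mul_right_comm]
    refine Ideal.mem_sup_right (Ideal.mul_mem_right _ _ ?_)
    have := Ideal.mul_mem_mul (Ideal.pow_mem_pow (const_mem_blowupIdeal (π := π) (r := r) (n := n))
      (k - i)) (Ideal.pow_mem_pow (coordZ_mem_blowupIdeal (π := π) (r := r) (n := n)) i)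
    rw [← pow_add] at this
    exact Ideal.pow_le_pow_right (by omega) this

theorem map_blowupIdeal_le {ψ : Blowup n π r →+* Disc R n}
    (hψ : ∀ a, ψ (toBlowup n π r a) = rescaleHom n (π ^ (r + 1)) a) :
    (blowupIdeal n π r).map ψ ≤ piZIdeal n π := by
  rw [Ideal.map_map, definingIdeal, Ideal.map_span, Ideal.span_le]
  have hp : const n π ∈ piZIdeal n π := Ideal.subset_span (by simp)
  rintro _ ⟨y, (rfl | rfl) | ⟨i, rfl⟩, rfl⟩
  · rw [RingHom.comp_apply, hψ, rescaleHom_const]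
    exact hp
  · rw [RingHom.comp_apply, hψ, rescaleHom_coordZ]
    exact Ideal.subset_span (by simp)
  · rw [RingHom.comp_apply, hψ, rescaleHom_coordS, const_pow, pow_succ, mul_right_comm]
    exact Ideal.mul_mem_left _ _ hp

variable [IsDomain R]

theorem const_mul_cancel {c : R} (hc : c ≠ 0) {a b : Disc R n}
    (h : const n c * a = const n c * b) : a = b := by
  refine disc_ext fun i α => mul_left_cancel₀ hc ?_
  rw [← discCoeff_const_mul, h, discCoeff_const_mul]

theorem const_mem_nonZeroDivisors {c : R} (hc : c ≠ 0) :
    const n c ∈ nonZeroDivisors (Disc R n) := by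
  refine mem_nonZeroDivisors_iff_right.2 fun x hx => const_mul_cancel hc ?_
  rw [mul_comm, hx, mul_zero]

theorem exists_blowup_lift (hπ : π ≠ 0) : ∃ ψ : Blowup n π r →+* Disc R n,
    ∀ a, ψ (toBlowup n π r a) = rescaleHom n (π ^ (r + 1)) a := by
  refine exists_blowupChart_lift _ _ (rescaleHom n (π ^ (r + 1))) ?_ fun x hx => ?_
  · rw [rescaleHom_const]
    exact const_mem_nonZeroDivisors (pow_ne_zero _ hπ)
  · have hle : (centre n π r).map (rescaleHom n (π ^ (r + 1))) ≤
        Ideal.span {const n (π ^ (r + 1))} := ?_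
    · rw [rescaleHom_const, ← Ideal.mem_span_singleton]
      exact hle (Ideal.mem_map_of_mem _ hx)
    rw [centre, Ideal.map_span, Ideal.span_le]
    rintro _ ⟨y, rfl | ⟨i, rfl⟩, rfl⟩
    · rw [rescaleHom_const]
      exact Ideal.mem_span_singleton_self _
    · rw [rescaleHom_coordS]
      exact Ideal.mul_mem_right _ _ (Ideal.mem_span_singleton_self _)

/-- The composite is the inclusion of polynomials into power series: cancelling `π ^ (r + 1)` shows
that `ψ (T i)` is a coordinate. -/
theorem discCoeff_evalBlowup (hπ : π ≠ 0) {T : Fin n → Blowup n π r}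
    (hT : ∀ i, toBlowup n π r (const n (π ^ (r + 1))) * T i = toBlowup n π r (coordS n i))
    {ψ : Blowup n π r →+* Disc R n}
    (hψ : ∀ a, ψ (toBlowup n π r a) = rescaleHom n (π ^ (r + 1)) a)
    (p : Polynomial (MvPolynomial (Fin n) R)) (i : ℕ) (α : Fin n →₀ ℕ) :
    discCoeff i α (ψ (evalBlowup T p)) = MvPolynomial.coeff α (p.coeff i) := by
  have h : ψ.comp (evalBlowup T) = (Polynomial.coeToPowerSeries.ringHom).comp
      (Polynomial.mapRingHom MvPolynomial.coeToMvPowerSeries.ringHom) := by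
    refine Polynomial.ringHom_ext' (MvPolynomial.ringHom_ext (fun c => ?_) fun i => ?_) ?_
    · simp only [RingHom.comp_apply]
      rw [evalBlowup_const, hψ, rescaleHom_const]
      simp [const]
    · simp only [RingHom.comp_apply]
      rw [evalBlowup_C_X]
      have h1 := congrArg ψ (hT i)
      rw [map_mul, hψ, hψ, rescaleHom_const, rescaleHom_coordS] at h1
      rw [const_mul_cancel (pow_ne_zero _ hπ) h1]
      simp [coordS]
    · simp only [RingHom.comp_apply]
      rw [evalBlowup_X, hψ, rescaleHom_coordZ]
      simp [coordZ]
  rw [← RingHom.comp_apply, h]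
  simp [discCoeff_apply]

/-- Replacing `y` by a polynomial approximation preserves the divisibility, because `ψ` is
compatible with the ideals; for a polynomial the coefficients can be read off. -/
theorem mem_sup_of_dvd_lift (hπ : π ≠ 0) {ψ : Blowup n π r →+* Disc R n}
    (hψ : ∀ a, ψ (toBlowup n π r a) = rescaleHom n (π ^ (r + 1)) a) {N k : ℕ} {y : Blowup n π r}
    (hy : ∀ i α, π ^ min N (k - i) ∣ discCoeff i α (ψ y)) :
    y ∈ Ideal.span {toBlowup n π r (const n π) ^ N} ⊔ blowupIdeal n π r ^ k := by
  obtain ⟨T, hT⟩ := exists_blowupCoord n π r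
  obtain ⟨p, hp⟩ := exists_evalBlowup_sub_mem hT k y
  rw [← sub_add_cancel y (evalBlowup T p)]
  refine add_mem (Ideal.mem_sup_right hp) (evalBlowup_mem fun i α => ?_)
  rw [← discCoeff_evalBlowup hπ hT hψ]
  have h1 : ψ (y - evalBlowup T p) ∈ piZIdeal n π ^ k := by
    refine Ideal.pow_right_mono (map_blowupIdeal_le hψ) k ?_
    rw [← Ideal.map_pow]
    exact Ideal.mem_map_of_mem _ hp
  have h2 := (pow_dvd_pow π (min_le_right N (k - i))).trans (mem_piZIdeal_pow.1 h1 i α)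
  rw [map_sub, map_sub] at h2
  exact (dvd_sub_right (hy i α)).1 h2

/-- A homomorphism to `R[[T₁, …, Tₙ, Z]]` that detects `π ^ N` modulo powers of an ideal `J`
extends to the `J`-adic completion and detects divisibility by `π ^ N` there. -/
theorem exists_completion_lift {B : Type*} [CommRing B] (hπ : π ≠ 0)
    (hc : IsAdicComplete (Ideal.span {π}) R) (J : Ideal B) (ψ : B →+* Disc R n) (p : B)
    (hpJ : p ∈ J) (hp : ψ p = const n π) (hle : J.map ψ ≤ piZIdeal n π)
    (hdet : ∀ (N k : ℕ) (y : B), (∀ i α, π ^ min N (k - i) ∣ discCoeff i α (ψ y)) →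
      y ∈ Ideal.span {p ^ N} ⊔ J ^ k) :
    ∃ Ψ : AdicCompletion J B →+* Disc R n,
      (∀ b, Ψ (AdicCompletion.of J B b) = ψ b) ∧
      ∀ (N : ℕ) (x : AdicCompletion J B), const n π ^ N ∣ Ψ x →
        AdicCompletion.of J B p ^ N ∣ x := by
  have hcE := isAdicComplete_piZIdeal (n := n) hc
  let Ψ : AdicCompletion J B →+* Disc R n := IsAdicComplete.liftRingHom (piZIdeal n π)
    (fun m => (quotPow J (piZIdeal n π) ψ hle m).comp
      (AdicCompletion.evalₐ J m : AdicCompletion J B →+* _))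
    (fun h => quotPow_compat _ _ ψ hle h)
  have hΨ : ∀ (x : AdicCompletion J B) (m : ℕ) (y : B),
      AdicCompletion.evalₐ J m x = Ideal.Quotient.mk _ y →
      Ψ x - ψ y ∈ piZIdeal n π ^ m := by
    intro x m y hxy
    rw [← Ideal.Quotient.eq, IsAdicComplete.mk_liftRingHom, RingHom.comp_apply, RingHom.coe_coe,
      hxy, quotPow, Ideal.quotientMap_mk]
  have hψJ : ∀ (k : ℕ) (y : B), y ∈ J ^ k → ψ y ∈ piZIdeal n π ^ k := by
    intro k y hy
    refine Ideal.pow_right_mono hle k ?_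
    rw [← Ideal.map_pow]
    exact Ideal.mem_map_of_mem _ hy
  refine ⟨Ψ, fun b => ?_, fun N x hx => ?_⟩
  · rw [← sub_eq_zero]
    refine hcE.toIsHausdorff.haus _ fun m => ?_
    rw [SModEq.zero, smul_eq_mul, Ideal.mul_top]
    exact hΨ _ m _ (AdicCompletion.evalₐ_of J m b)
  obtain ⟨s, hs, hs'⟩ := exists_adicSequence _ x
  have h1 : ∀ k, ∃ y, s k - p ^ N * y ∈ J ^ k := by
    intro k
    have h2 : s k ∈ Ideal.span {p ^ N} ⊔ J ^ k := by
      refine hdet N k _ fun i α => ?_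
      have h3 := (pow_dvd_pow π (min_le_right N (k - i))).trans
        (mem_piZIdeal_pow.1 (hΨ x k _ (hs k)) i α)
      have h4 := (pow_dvd_pow π (min_le_left N (k - i))).trans (const_pow_dvd_iff.1 hx i α)
      rw [map_sub] at h3
      exact (dvd_sub_right h4).1 h3
    obtain ⟨u, hu, v, hv, huv⟩ := Submodule.mem_sup.1 h2
    obtain ⟨y, rfl⟩ := Ideal.mem_span_singleton.1 hu
    exact ⟨y, by rw [← huv, add_sub_cancel_left]; exact hv⟩
  choose y hy using h1
  -- Division by `p ^ N` costs `N` steps of precision, hence the shifted sequence `y (m + N)` below.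
  have h5 : ∀ k, y (k + 1) - y k ∈ J ^ (k - N) := by
    intro k
    have h6 : p ^ N * (y (k + 1) - y k) ∈ J ^ k := by
      have h7 := Ideal.pow_le_pow_right (Nat.le_succ k) (hy (k + 1))
      have h8 := sub_mem (add_mem (hs' k (k + 1) (Nat.le_succ k)) (hy k)) h7
      convert h8 using 1
      ring
    have h9 := hψJ k _ h6
    rw [map_mul, map_pow, hp] at h9
    have h10 : y (k + 1) - y k ∈ Ideal.span {p ^ (k - N)} ⊔ J ^ (k - N) := by
      refine hdet _ _ _ fun i α => ?_
      have h11 := mem_piZIdeal_pow.1 h9 i α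
      rw [discCoeff_const_pow_mul] at h11
      rcases le_total N (k - i) with h | h
      · rw [← Nat.add_sub_cancel' h, pow_add,
          mul_dvd_mul_iff_left (pow_ne_zero N hπ)] at h11
        exact (pow_dvd_pow π (by omega)).trans h11
      · rw [show min (k - N) (k - N - i) = 0 by omega, pow_zero]
        exact one_dvd _
    refine (sup_le ?_ le_rfl : _ ≤ J ^ (k - N)) h10
    rw [Ideal.span_singleton_le_iff_mem]
    exact Ideal.pow_mem_pow hpJ _
  obtain ⟨z, hz⟩ := exists_adicCompletion J (fun m => y (m + N)) fun m => by
    have := h5 (m + N)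
    rwa [Nat.add_sub_cancel, Nat.add_right_comm] at this
  refine ⟨z, AdicCompletion.ext_evalₐ fun m => ?_⟩
  rw [map_mul, map_pow, AdicCompletion.evalₐ_of, hz, hs, ← map_pow, ← map_mul, Ideal.Quotient.eq]
  have h12 := Ideal.pow_le_pow_right (Nat.le_add_right m N) (hy (m + N))
  have h13 := sub_mem h12 (hs' m (m + N) (Nat.le_add_right m N))
  convert h13 using 1
  ring

/-- The ring of functions on `𝔛'` maps to `R[[T₁, …, Tₙ, Z]]`, where `Sᵢ = π ^ (r + 1) * Tᵢ`, and
divisibility by powers of `π` can be tested after this homomorphism. -/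
theorem exists_chart_lift (hπ : π ≠ 0) (hc : IsAdicComplete (Ideal.span {π}) R) (n r : ℕ) :
    ∃ Ψ : Chart n π r →+* Disc R n,
      (∀ a, Ψ (toChart n π r a) = rescaleHom n (π ^ (r + 1)) a) ∧
      ∀ (N : ℕ) (x : Chart n π r), const n π ^ N ∣ Ψ x → toChart n π r (const n π) ^ N ∣ x := by
  obtain ⟨ψ, hψ⟩ := exists_blowup_lift (n := n) (r := r) hπ
  obtain ⟨Ψ, h1, h2⟩ := exists_completion_lift hπ hc (blowupIdeal n π r) ψ
    (toBlowup n π r (const n π)) const_mem_blowupIdeal (by rw [hψ, rescaleHom_const])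
    (map_blowupIdeal_le hψ) fun N k y hy => mem_sup_of_dvd_lift hπ hψ hy
  exact ⟨Ψ, fun a => (h1 _).trans (hψ a), h2⟩

end Chart

/-! ### Cancelling the distinguished series modulo powers of the uniformizer -/

section Gluing

variable {R : Type*} [CommRing R] {n : ℕ}

theorem const_pow_dvd_of_dvd_coordZ_pow_mul {π : R} {N l : ℕ} {a : Disc R n}
    (h : const n π ^ N ∣ coordZ n ^ l * a) : const n π ^ N ∣ a := by
  rw [const_pow_dvd_iff] at h ⊢
  intro i α
  have := h (i + l) α
  rwa [discCoeff_coordZ_pow_mul] at this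

variable [IsLocalRing R]

theorem IsZDistinguished.exists_rescaleHom_pow_mul {f : Disc R n} (hf : IsZDistinguished f)
    {π : R} (hπ : IsLocalRing.maximalIdeal R = Ideal.span {π}) {c : R} (hc : π ∣ c) (N t : ℕ) :
    ∃ (l : ℕ) (q e : Disc R n),
      rescaleHom n c f ^ t * rescaleHom n c q = coordZ n ^ l + const n π ^ N * e := by
  obtain ⟨l, q, e, h⟩ := hf.exists_rescaleHom_mul hπ hc N
  have h1 : const n π ^ N ∣ rescaleHom n c f ^ t * rescaleHom n c (q ^ t) - coordZ n ^ (l * t) := by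
    rw [map_pow, ← mul_pow, ← map_mul, pow_mul]
    exact (Dvd.intro e (by rw [h]; ring)).trans (sub_dvd_pow_sub_pow _ _ t)
  obtain ⟨e', he'⟩ := h1
  exact ⟨l * t, q ^ t, e', by rw [← he']; ring⟩

/-- The rescaled `f` divides a power of `Z` modulo `π ^ N`, and `Z` is a nonzerodivisor there. -/
theorem IsZDistinguished.dvd_of_dvd_rescaleHom_pow_mul {f : Disc R n} (hf : IsZDistinguished f)
    {π : R} (hπ : IsLocalRing.maximalIdeal R = Ideal.span {π}) {c : R} (hc : π ∣ c) {N t : ℕ}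
    {w : Disc R n} (hw : const n π ^ N ∣ rescaleHom n c f ^ t * w) : const n π ^ N ∣ w := by
  obtain ⟨l, q, e, h⟩ := hf.exists_rescaleHom_pow_mul hπ hc N t
  refine const_pow_dvd_of_dvd_coordZ_pow_mul (l := l) ?_
  have e1 : coordZ n ^ l * w =
      rescaleHom n c f ^ t * w * rescaleHom n c q - const n π ^ N * (e * w) := by
    linear_combination (-w) * h
  rw [e1]
  exact dvd_sub (hw.mul_right _) (dvd_mul_right _ _)

/-- The coefficients of an approximate quotient of two power series in `S₁, …, Sₙ, Z`, written in
the coordinates `Tᵢ` with `Sᵢ = c * Tᵢ`, are approximately divisible by powers of `c`. -/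
theorem IsZDistinguished.exists_dvd_discCoeff_sub {f : Disc R n} (hf : IsZDistinguished f)
    {π : R} (hπ : IsLocalRing.maximalIdeal R = Ideal.span {π}) {c : R} (hc : π ∣ c) {N j : ℕ}
    {a x : Disc R n} (h : const n π ^ N ∣ rescaleHom n c a - rescaleHom n c f ^ j * x)
    (i : ℕ) (α : Fin n →₀ ℕ) : ∃ d, π ^ N ∣ discCoeff i α x - c ^ α.degree * d := by
  obtain ⟨l, q, e, hq⟩ := hf.exists_rescaleHom_pow_mul hπ hc N j
  have h1 : const n π ^ N ∣ coordZ n ^ l * x - rescaleHom n c (a * q) := by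
    have e1 : coordZ n ^ l * x - rescaleHom n c (a * q) =
        -((rescaleHom n c a - rescaleHom n c f ^ j * x) * rescaleHom n c q) -
          const n π ^ N * (e * x) := by
      rw [map_mul]
      linear_combination (-x) * hq
    rw [e1]
    exact dvd_sub ((h.mul_right _).neg_right) (dvd_mul_right _ _)
  have h2 := const_pow_dvd_iff.1 h1 (i + l) α
  rw [map_sub, discCoeff_coordZ_pow_mul, discCoeff_rescaleHom] at h2
  exact ⟨_, h2⟩

/-- Rescaling multiplies the coefficients at `α` of both `w` and `b * q` by `π ^ ((r + 1) * |α|)`.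
The extra precision in the hypothesis pays for cancelling this factor, which is why `α` is fixed. -/
theorem IsZDistinguished.pow_dvd_discCoeff [IsDomain R] {f : Disc R n} (hf : IsZDistinguished f)
    {π : R} (hπ : IsLocalRing.maximalIdeal R = Ideal.span {π}) (hπ0 : π ≠ 0) {r N t : ℕ}
    {w b : Disc R n} {α : Fin n →₀ ℕ}
    (h : const n π ^ (N + (r + 1) * α.degree) ∣
      rescaleHom n (π ^ (r + 1)) f ^ t * rescaleHom n (π ^ (r + 1)) w -
        const n π ^ N * rescaleHom n (π ^ (r + 1)) b) (i : ℕ) :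
    π ^ N ∣ discCoeff i α w := by
  obtain ⟨l, q, e, hq⟩ := hf.exists_rescaleHom_pow_mul hπ (dvd_pow_self π r.succ_ne_zero)
    (N + (r + 1) * α.degree) t
  have h1 : const n π ^ (N + (r + 1) * α.degree) ∣
      coordZ n ^ l * rescaleHom n (π ^ (r + 1)) w -
        const n π ^ N * rescaleHom n (π ^ (r + 1)) (b * q) := by
    have e1 : coordZ n ^ l * rescaleHom n (π ^ (r + 1)) w -
        const n π ^ N * rescaleHom n (π ^ (r + 1)) (b * q) =
        (rescaleHom n (π ^ (r + 1)) f ^ t * rescaleHom n (π ^ (r + 1)) w -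
          const n π ^ N * rescaleHom n (π ^ (r + 1)) b) * rescaleHom n (π ^ (r + 1)) q -
          const n π ^ (N + (r + 1) * α.degree) * (e * rescaleHom n (π ^ (r + 1)) w) := by
      rw [map_mul]
      linear_combination (-rescaleHom n (π ^ (r + 1)) w) * hq
    rw [e1]
    exact dvd_sub (h.mul_right _) (dvd_mul_right _ _)
  have h2 := const_pow_dvd_iff.1 h1 (i + l) α
  rw [map_sub, discCoeff_coordZ_pow_mul, discCoeff_rescaleHom, discCoeff_const_pow_mul,
    discCoeff_rescaleHom, ← pow_mul, mul_left_comm (π ^ N), ← mul_sub, pow_add, mul_comm (π ^ N),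
    mul_dvd_mul_iff_left (pow_ne_zero _ hπ0)] at h2
  exact (dvd_sub_left (dvd_mul_right _ _)).1 h2

end Gluing

/-! ### Functions on the envelopes: injectivity of the pullback and gluing -/

section Env

variable {R : Type*} [CommRing R] {n : ℕ}

theorem mem_piIdealChart_pow {π : R} {r m : ℕ} {x : Chart n π r} :
    x ∈ piIdealChart n π r ^ m ↔ toChart n π r (const n π) ^ m ∣ x :=
  mem_span_singleton_pow

/-- The compatibility of `g` and `h` in terms of representatives modulo `π ^ m`. -/
theorem dvd_awayMap_sub_of_pullEnvAway_eq {π : R} {r : ℕ} {f : Disc R n}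
    {g : EnvFunctionsAway π f} {h : EnvChartFunctions n π r}
    (hgh : pullEnvAway π r f g = resChart π r f h) {m : ℕ} {y : Localization.Away f}
    {x : Chart n π r} (hy : AdicCompletion.evalₐ _ m g = Ideal.Quotient.mk _ y)
    (hx : AdicCompletion.evalₐ _ m h = Ideal.Quotient.mk _ x) :
    algebraMap _ (Localization.Away (toChart n π r f)) (toChart n π r (const n π) ^ m) ∣
      Localization.awayMap (toChart n π r) f y -
        algebraMap _ (Localization.Away (toChart n π r f)) x := by
  have h1 := evalₐ_pullback _ _ (Localization.awayMap (toChart n π r) f)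
    (map_awayMap_le _ _ _ (map_piIdeal_le n π r) f) m g y hy
  have h2 := evalₐ_pullback _ _ (algebraMap _ (Localization.Away (toChart n π r f))) le_rfl m h x hx
  have h3 := h1.symm.trans ((congrArg (AdicCompletion.evalₐ _ m) hgh).trans h2)
  rw [map_pow]
  exact (mem_map_span_singleton_pow _).1 (Ideal.Quotient.eq.1 h3)

theorem EnvFunctions.exists_eq_of {π : R} (hc : IsAdicComplete (Ideal.span {π}) R)
    (u : EnvFunctions n π) : ∃ a, AdicCompletion.of (piIdeal n π) (Disc R n) a = u := by
  have := isAdicComplete_piIdeal (n := n) hc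
  exact AdicCompletion.of_surjective (piIdeal n π) (Disc R n) u

theorem evalₐ_pullEnv_of {π : R} (r m : ℕ) (a : Disc R n) :
    AdicCompletion.evalₐ _ m (pullEnv n π r (AdicCompletion.of (piIdeal n π) (Disc R n) a)) =
      Ideal.Quotient.mk _ (toChart n π r a) :=
  evalₐ_pullback _ _ _ _ m _ a (AdicCompletion.evalₐ_of _ m a)

theorem evalₐ_resEnv_of {π : R} (f : Disc R n) (m : ℕ) (a : Disc R n) :
    AdicCompletion.evalₐ _ m (resEnv π f (AdicCompletion.of (piIdeal n π) (Disc R n) a)) =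
      Ideal.Quotient.mk _ (algebraMap _ (Localization.Away f) a) :=
  evalₐ_pullback _ _ _ _ m _ a (AdicCompletion.evalₐ_of _ m a)

variable [IsDomain R]

theorem rescaleHom_injective {c : R} (hc : c ≠ 0) : Function.Injective (rescaleHom n c) := by
  intro a b h
  refine disc_ext fun i α => mul_left_cancel₀ (pow_ne_zero α.degree hc) ?_
  rw [← discCoeff_rescaleHom, h, discCoeff_rescaleHom]

theorem pullEnv_injective {π : R} (hπ : π ≠ 0) (hc : IsAdicComplete (Ideal.span {π}) R)
    (n r : ℕ) : Function.Injective (pullEnv n π r) := by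
  intro u v huv
  obtain ⟨Ψ, hΨ, -⟩ := exists_chart_lift hπ hc n r
  obtain ⟨a, rfl⟩ := EnvFunctions.exists_eq_of hc u
  obtain ⟨b, rfl⟩ := EnvFunctions.exists_eq_of hc v
  congr 1
  refine rescaleHom_injective (pow_ne_zero (r + 1) hπ) (sub_eq_zero.1 ?_)
  refine (isAdicComplete_piIdeal (n := n) hc).toIsHausdorff.haus _ fun m => ?_
  rw [SModEq.zero, smul_eq_mul, Ideal.mul_top, piIdeal, mem_span_singleton_pow]
  have h1 := congrArg (AdicCompletion.evalₐ _ m) huv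
  rw [evalₐ_pullEnv_of, evalₐ_pullEnv_of, Ideal.Quotient.eq, mem_piIdealChart_pow] at h1
  have h2 := map_dvd Ψ h1
  rwa [map_pow, map_sub, hΨ, hΨ, hΨ, rescaleHom_const] at h2

theorem exists_resEnv_eq_and_pullEnv_eq [IsLocalRing R] {π : R}
    (hm : IsLocalRing.maximalIdeal R = Ideal.span {π}) (hπ : π ≠ 0)
    (hc : IsAdicComplete (Ideal.span {π}) R) {r : ℕ} {f : Disc R n} (hf : IsZDistinguished f)
    {g : EnvFunctionsAway π f} {h : EnvChartFunctions n π r}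
    (hgh : pullEnvAway π r f g = resChart π r f h) :
    ∃ u : EnvFunctions n π, resEnv π f u = g ∧ pullEnv n π r u = h := by
  obtain ⟨Ψ, hΨ, hdet⟩ := exists_chart_lift hπ hc n r
  let φ := rescaleHom n (π ^ (r + 1))
  have hπc : π ∣ π ^ (r + 1) := dvd_pow_self π r.succ_ne_zero
  have hΨπ : Ψ (toChart n π r (const n π)) = const n π := by rw [hΨ, rescaleHom_const]
  obtain ⟨y, hy, hy'⟩ := exists_adicSequence _ g
  obtain ⟨x, hx, hx'⟩ := exists_adicSequence _ h
  have hya : ∀ m, ∃ (j : ℕ) (a : Disc R n), y m * algebraMap _ (Localization.Away f) f ^ j =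
      algebraMap _ (Localization.Away f) a := fun m => IsLocalization.Away.surj f (y m)
  choose j a hja using hya
  -- Compatibility of `g` and `h` gives this only after multiplication by a power of `φ f`, which
  -- can be cancelled.
  have hax : ∀ m, const n π ^ m ∣ φ (a m) - φ f ^ j m * Ψ (x m) := by
    intro m
    obtain ⟨t, b, hb⟩ := exists_of_dvd_awayMap_sub (toChart n π r) (hja m)
      (dvd_awayMap_sub_of_pullEnvAway_eq hgh (hy m) (hx m))
    have h1 := congrArg Ψ hb
    simp only [map_mul, map_pow, map_sub, hΨ, rescaleHom_const] at h1
    exact hf.dvd_of_dvd_rescaleHom_pow_mul hm hπc (Dvd.intro _ h1.symm)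
  obtain ⟨e, he⟩ := exists_sub_mem_of_complete (isAdicComplete_piIdeal (n := n) hc)
    (fun m => Ψ (x m)) fun m k hmk => by
      have h1 := map_dvd Ψ (mem_piIdealChart_pow.1 (hx' m k hmk))
      rw [map_pow, hΨπ, map_sub] at h1
      exact mem_span_singleton_pow.2 h1
  have he' : ∀ m, const n π ^ m ∣ e - Ψ (x m) := fun m => mem_span_singleton_pow.1 (he m)
  -- At precision `(r + 1) * |α|` the error terms are themselves divisible by the required power.
  have hcoeff : ∀ i α, ∃ d, discCoeff i α e = (π ^ (r + 1)) ^ α.degree * d := by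
    intro i α
    obtain ⟨d, hd⟩ := hf.exists_dvd_discCoeff_sub hm hπc (hax ((r + 1) * α.degree)) i α
    have h1 := const_pow_dvd_iff.1 (he' ((r + 1) * α.degree)) i α
    rw [pow_mul, map_sub] at h1
    rw [pow_mul] at hd
    have h2 := dvd_add (dvd_add h1 hd) (dvd_mul_right ((π ^ (r + 1)) ^ α.degree) d)
    rwa [sub_add_sub_cancel, sub_add_cancel] at h2
  choose d hd using hcoeff
  obtain rfl : φ (discMk d) = e := disc_ext fun i α => by
    rw [discCoeff_rescaleHom, discCoeff_discMk, hd]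
  set u := discMk d
  refine ⟨AdicCompletion.of _ _ u, AdicCompletion.ext_evalₐ fun N => ?_,
    AdicCompletion.ext_evalₐ fun m => ?_⟩
  · rw [evalₐ_resEnv_of, hy, eq_comm, Ideal.Quotient.eq, piIdeal, mem_map_span_singleton_pow,
      ← map_pow]
    have hw : const n π ^ N ∣ a N - f ^ j N * u := by
      refine const_pow_dvd_iff.2 fun i α => ?_
      -- The finer approximation `a M / f ^ j M` of `g` agrees with `u` modulo `π ^ M` after
      -- rescaling, and with `a N / f ^ j N` modulo `π ^ N` before it.
      obtain ⟨M, hM⟩ : ∃ M, M = N + (r + 1) * α.degree := ⟨_, rfl⟩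
      have h1 : const n π ^ M ∣ φ (a M) - φ f ^ j M * φ u := by
        have := dvd_sub (hax M) ((he' M).mul_left (φ f ^ j M))
        convert this using 1
        ring
      have h2 : algebraMap _ (Localization.Away f) (const n π ^ N) ∣
          algebraMap _ (Localization.Away f) (a M * f ^ j N - a N * f ^ j M) := by
        have := mem_map_span_singleton_pow _ |>.1 (hy' N M (by omega))
        rw [← map_pow] at this
        simp only [map_sub, map_mul, ← hja, map_pow (algebraMap _ _) f]
        exact (this.mul_right (algebraMap _ (Localization.Away f) f ^ j N *
          algebraMap _ (Localization.Away f) f ^ j M)).trans (dvd_of_eq (by ring))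
      obtain ⟨t, b, hb⟩ := exists_of_dvd_away h2
      -- By `hb`, exchanging `a N * f ^ j M` for `a M * f ^ j N` costs the term `π ^ N * b`; what
      -- remains is a multiple of `h1`.
      refine hf.pow_dvd_discCoeff hm hπ (r := r) (t := t + j M) (b := -b) ?_ i
      rw [← hM]
      have h3 := congrArg φ hb
      have h4 := h1.mul_left (φ f ^ (t + j N))
      simp only [map_mul, map_pow, map_sub] at h3
      convert h4 using 1
      simp only [map_mul, map_pow, map_sub, map_neg]
      rw [show φ (const n π) = const n π from rescaleHom_const _ _] at h3
      change φ f ^ (t + j M) * (φ (a N) - φ f ^ j N * φ u) - const n π ^ N * -φ b = _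
      linear_combination (-1 : Disc R n) * h3
    have h5 := map_dvd (algebraMap _ (Localization.Away f)) hw
    rw [map_sub, ← hja, map_mul, map_pow _ f, mul_comm (_ ^ _), ← sub_mul] at h5
    exact ((IsLocalization.Away.algebraMap_isUnit f).pow _).dvd_mul_right.1 h5
  · rw [evalₐ_pullEnv_of, hx, Ideal.Quotient.eq, mem_piIdealChart_pow]
    refine hdet m _ ?_
    rw [map_sub, hΨ]
    exact he' m

end Env

end FormalHartogs

theorem theorem2p3p3p1 {R : Type*} [CommRing R] [IsDomain R] [IsDiscreteValuationRing R]
    [IsAdicComplete (IsLocalRing.maximalIdeal R) R] (π : R) (hπ : Irreducible π)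
    (n r : ℕ) (f : FormalHartogs.Disc R n) (hf : FormalHartogs.IsZDistinguished f)
    (g : FormalHartogs.EnvFunctionsAway π f) (h : FormalHartogs.EnvChartFunctions n π r)
    (hgh : FormalHartogs.pullEnvAway π r f g = FormalHartogs.resChart π r f h) :
    ∃! u : FormalHartogs.EnvFunctions n π,
      FormalHartogs.resEnv π f u = g ∧ FormalHartogs.pullEnv n π r u = h := by
  have hm := hπ.maximalIdeal_eq
  have hc : IsAdicComplete (Ideal.span {π}) R := hm ▸ inferInstance
  obtain ⟨u, hug, huh⟩ := FormalHartogs.exists_resEnv_eq_and_pullEnv_eq hm hπ.ne_zero hc hf hgh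
  exact ⟨u, ⟨hug, huh⟩, fun v hv =>
    FormalHartogs.pullEnv_injective hπ.ne_zero hc n r (hv.2.trans huh.symm)⟩
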